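/- Let $n\ge 0$. A polytope is the convex hull of a finite set of points. For a polytope $P\subset\mathbb{R}^m$ and $z\in P$ let $\rho_zP=2z-P$ be its reflection with respect to $z$. A vector $\vec v\in\mathbb{R}^m$ \emph{positively orients} $P$ if, for every $z\in P$, $\vec v$ is not perpendicular to any edge of $P\cap\rho_zP$. In this case the diagonal map of $(P,\vec v)$ is $$\triangle_{(P,\vec v)}:P\to P\times P,\qquad z\mapsto\bigl(\mathrm{bot}_{\vec v}(P\cap\rho_zP),\ \mathrm{top}_{\vec v}(P\cap\rho_zP)\bigr),$$ where $\mathrm{bot}_{\vec v}(S)$ and $\mathrm{top}_{\vec v}(S)$ are the unique vertices of $S$ which minimize, respectively maximize, the scalar product $\langle -,\vec v\rangle$ over $S$. A \emph{generalized permutahedron} in $\mathbb{R}^{n+1}$ is a set of the form $$\Bigl\{x\in\mathbb{R}^{n+1} : \sum_{i=1}^{n+1}x_i=z_{[n+1]},\ \sum_{i\in I}x_i\ge z_I\text{ for all }I\subseteq[n+1]\Bigr\},$$ where the real numbers $z_I$ satisfy $z_\emptyset=0$ and $z_I+z_J\le z_{I\cup J}+z_{I\cap J}$ for all $I,J\subseteq[n+1]$.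 A \emph{good orientation vector} is a vector $\vec v=(v_1,\dots,v_{n+1})\in\mathbb{R}^{n+1}$ with $v_i\ge 2v_{i+1}$ for $1\le i\le n$ and $v_{n+1}>0$. Let $\pi:\mathbb{R}^{n+1}\to\mathbb{R}^n$ be the projection forgetting the last coordinate. Let $P\subset\mathbb{R}^{n+1}$ be a generalized permutahedron and let $\vec v\in\mathbb{R}^{n+1}$ be a good orientation vector. Then $P$ is a polytope positively oriented by $\vec v$, and $\pi(P)$ is a polytope positively oriented by $\pi(\vec v)$. The minimizing and maximizing vertices in the definition of the diagonal maps of $(P,\vec v)$ and $(\pi(P),\pi(\vec v))$ exist and are unique. Moreover, the projection $\pi$ commutes with the diagonal maps of $P$ and $\pi(P)$: $$\triangle_{(\pi(P),\pi(\vec v))}(\pi(z))=(\pi\times\pi)\bigl(\triangle_{(P,\vec v)}(z)\bigr)\qquad\text{for all }z\in P .$$ -/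

import Mathlib

namespace OrientedPolytope

/-- A polytope in `ℝ^m`: the convex hull of finitely many points. -/
def IsPolytope {m : ℕ} (P : Set (EuclideanSpace ℝ (Fin m))) : Prop :=
  ∃ T : Finset (EuclideanSpace ℝ (Fin m)), P = convexHull ℝ (T : Set (EuclideanSpace ℝ (Fin m)))

/-- The reflection `ρ_z P = 2z - P` of `P` with respect to the point `z`. -/
def reflection {m : ℕ} (z : EuclideanSpace ℝ (Fin m)) (P : Set (EuclideanSpace ℝ (Fin m))) :
    Set (EuclideanSpace ℝ (Fin m)) :=
  (fun x => (2 : ℝ) • z - x) '' P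

/-- The segment `[a, b]` is an edge, i.e. a one-dimensional face, of `S`. (A face of a polytope is
the set of maximizers of a linear functional.) -/
def IsEdge {m : ℕ} (S : Set (EuclideanSpace ℝ (Fin m))) (a b : EuclideanSpace ℝ (Fin m)) : Prop :=
  a ≠ b ∧ IsExposed ℝ S (segment ℝ a b)

/-- `(P, v)` is a positively oriented polytope: `P` is a polytope and `v` is not perpendicular to
any edge of `P ∩ ρ_z P`, for any `z ∈ P`. -/
def IsPositivelyOriented {m : ℕ} (P : Set (EuclideanSpace ℝ (Fin m)))
    (v : EuclideanSpace ℝ (Fin m)) : Prop :=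
  IsPolytope P ∧
    ∀ z ∈ P, ∀ a b, IsEdge (P ∩ reflection z P) a b → inner ℝ (b - a) v ≠ 0

/-- `x` is a vertex of `S` which minimizes the scalar product with `v` over `S`. -/
def IsBottomVertex {m : ℕ} (v : EuclideanSpace ℝ (Fin m)) (S : Set (EuclideanSpace ℝ (Fin m)))
    (x : EuclideanSpace ℝ (Fin m)) : Prop :=
  x ∈ S.extremePoints ℝ ∧ ∀ y ∈ S, inner ℝ x v ≤ inner ℝ y v

/-- `x` is a vertex of `S` which maximizes the scalar product with `v` over `S`. -/
def IsTopVertex {m : ℕ} (v : EuclideanSpace ℝ (Fin m)) (S : Set (EuclideanSpace ℝ (Fin m)))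
    (x : EuclideanSpace ℝ (Fin m)) : Prop :=
  x ∈ S.extremePoints ℝ ∧ ∀ y ∈ S, inner ℝ y v ≤ inner ℝ x v

theorem exists_isTopVertex {m : ℕ} {P : Set (EuclideanSpace ℝ (Fin m))} (hP : IsPolytope P)
    (v : EuclideanSpace ℝ (Fin m)) {z : EuclideanSpace ℝ (Fin m)} (hz : z ∈ P) :
    ∃ x, IsTopVertex v (P ∩ reflection z P) x := by
  obtain ⟨T, rfl⟩ := hP
  set P := convexHull ℝ (T : Set (EuclideanSpace ℝ (Fin m))) with hPdef
  have hc : IsCompact P := T.finite_toSet.isCompact_convexHull (𝕜 := ℝ)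
  have hr : IsCompact (reflection z P) := hc.image (by fun_prop)
  have hS : IsCompact (P ∩ reflection z P) := hc.inter hr
  have hne : (P ∩ reflection z P).Nonempty := ⟨z, hz, z, hz, by simp [two_smul]⟩
  have hcont : Continuous fun x : EuclideanSpace ℝ (Fin m) => inner ℝ x v := by fun_prop
  obtain ⟨x₀, hx₀, hmax⟩ := hS.exists_isMaxOn hne hcont.continuousOn
  have hexp : IsExposed ℝ (P ∩ reflection z P) ((innerSL ℝ v).toExposed (P ∩ reflection z P)) :=
    ContinuousLinearMap.toExposed.isExposed
  have hFne : ((innerSL ℝ v).toExposed (P ∩ reflection z P)).Nonempty := by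
    refine ⟨x₀, hx₀, fun y hy => ?_⟩
    have h := hmax hy
    simp only [innerSL_apply_apply]
    rw [real_inner_comm y v, real_inner_comm x₀ v]
    exact h
  obtain ⟨x, hx⟩ := (hexp.isCompact hS).extremePoints_nonempty hFne
  refine ⟨x, hexp.isExtreme.extremePoints_subset_extremePoints hx, fun y hy => ?_⟩
  have h := hx.1.2 y hy
  simp only [innerSL_apply_apply] at h
  rwa [real_inner_comm y v, real_inner_comm x v] at h

theorem exists_isBottomVertex {m : ℕ} {P : Set (EuclideanSpace ℝ (Fin m))} (hP : IsPolytope P)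
    (v : EuclideanSpace ℝ (Fin m)) {z : EuclideanSpace ℝ (Fin m)} (hz : z ∈ P) :
    ∃ x, IsBottomVertex v (P ∩ reflection z P) x := by
  obtain ⟨x, hx, h⟩ := exists_isTopVertex hP (-v) hz
  exact ⟨x, hx, fun y hy => by simpa [inner_neg_right] using h y hy⟩

/-- The vertices of `P ∩ ρ_z P` which minimize, respectively maximize, the scalar product with `v`
are unique, for every `z ∈ P`. -/
def HasUniqueBottomTop {m : ℕ} (P : Set (EuclideanSpace ℝ (Fin m)))
    (v : EuclideanSpace ℝ (Fin m)) : Prop :=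
  ∀ z ∈ P, (∃! x, IsBottomVertex v (P ∩ reflection z P) x) ∧
    (∃! x, IsTopVertex v (P ∩ reflection z P) x)

/-- The diagonal map `P → P × P` of the positively oriented polytope `(P, v)`, which sends `z` to
the pair (bottom vertex, top vertex) of `P ∩ ρ_z P` with respect to `v`. -/
noncomputable def diagonalMap {m : ℕ} {P : Set (EuclideanSpace ℝ (Fin m))}
    {v : EuclideanSpace ℝ (Fin m)} (h : IsPositivelyOriented P v) (z : P) : P × P :=
  (⟨(exists_isBottomVertex h.1 v z.2).choose,
      (exists_isBottomVertex h.1 v z.2).choose_spec.1.1.1⟩,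
    ⟨(exists_isTopVertex h.1 v z.2).choose,
      (exists_isTopVertex h.1 v z.2).choose_spec.1.1.1⟩)

/-- A generalized permutahedron in `ℝ^m`: a set of the form
`{x | ∑ i, x i = z_[m], ∑ i ∈ I, x i ≥ z_I for all I ⊆ [m]}`, where `z` is supermodular and
`z_∅ = 0`. -/
def IsGeneralizedPermutahedron {m : ℕ} (P : Set (EuclideanSpace ℝ (Fin m))) : Prop :=
  ∃ z : Finset (Fin m) → ℝ, z ∅ = 0 ∧
    (∀ I J : Finset (Fin m), z I + z J ≤ z (I ∪ J) + z (I ∩ J)) ∧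
    P = {x | ∑ i, x i = z Finset.univ ∧ ∀ I : Finset (Fin m), z I ≤ ∑ i ∈ I, x i}

/-- A good orientation vector `v = (v_1, …, v_{n+1})`: `v_i ≥ 2 v_{i+1}` for `1 ≤ i ≤ n`, and
`v_{n+1} > 0`. -/
def IsGoodOrientation {n : ℕ} (v : EuclideanSpace ℝ (Fin (n + 1))) : Prop :=
  (∀ i : Fin n, 2 * v i.succ ≤ v i.castSucc) ∧ 0 < v (Fin.last n)

/-- The projection `ℝ^{n+1} → ℝ^n` forgetting the last coordinate. -/
def proj {n : ℕ} (x : EuclideanSpace ℝ (Fin (n + 1))) : EuclideanSpace ℝ (Fin n) :=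
  WithLp.toLp 2 fun i => x i.castSucc

/-- The restriction `P → π(P)` of the projection `proj` to a subset `P`. -/
def projOn {n : ℕ} (P : Set (EuclideanSpace ℝ (Fin (n + 1)))) (x : P) : ↥(proj '' P) :=
  ⟨proj x.1, Set.mem_image_of_mem proj x.2⟩

end OrientedPolytope

open OrientedPolytope

/-!
For a generalized permutahedron `P` and `w ∈ P`, everything rests on a symmetric exchange property
of `S = P ∩ ρ_w P`: for distinct `x, y ∈ S` there are disjoint nonempty sets `I, J` of coordinates
with `|I| = |J|` such that, for some `ε > 0` and `c = 1_I - 1_J`, both `x + ε c` and `y - ε c` lie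
in `S` (`exists_exchange_inter_reflection`). It is assembled from the classical exchange property of
base polytopes (`exists_exchange`), applied in `P` and, after reflection, in `ρ_w P`: the two
exchanges give maps back and forth between the coordinates that increase and those that decrease
from `x` to `y`, and on a set permuted by their composite the exchanges add up to a common
direction.

A good orientation vector is superdecreasing, so the sign of `⟨c, v⟩` is that of the first nonzero
entry of `c`. This entry is not the last one, since the entries of `c` sum to zero; hence `⟨c, v⟩`
and `⟨π c, π v⟩` are nonzero of the same sign (`IsGoodOrientation.inner_mul_inner_proj_pos`).

The claims follow formally. Between the ends of an edge, an exchange is parallel to the edge, so the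
edge is not perpendicular to `v`. Between two top vertices, it would increase `⟨-, v⟩` at one of
them, so the top vertex is unique. Between the top vertex of `S` and a preimage of the top vertex of
`π S`, it would increase `⟨-, v⟩` at the former or `⟨π -, π v⟩` at the latter, so `π` preserves top
vertices; bottom vertices are the top vertices for `-v`. Finally `π` is injective on the hyperplane
containing `P`, which identifies `π P ∩ ρ_{π w} π P` with `π S`. That `P` is the convex hull of a
finite set is the Krein–Milman theorem together with the finiteness of the set of extreme points
(`finite_extremePoints_basePolytope`).
-/

namespace OrientedPolytope

open Filter Topology

/-! ### Base polytopes -/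

/-- The base polytope cut out by the parameters `z`: the set appearing in the definition of a
generalized permutahedron, for arbitrary `z`. -/
def basePolytope {m : ℕ} (z : Finset (Fin m) → ℝ) : Set (EuclideanSpace ℝ (Fin m)) :=
  {x | ∑ i, x i = z Finset.univ ∧ ∀ I : Finset (Fin m), z I ≤ ∑ i ∈ I, x i}

section Base

variable {m : ℕ} {z : Finset (Fin m) → ℝ} {x y : EuclideanSpace ℝ (Fin m)}

theorem convex_basePolytope (z : Finset (Fin m) → ℝ) : Convex ℝ (basePolytope z) := by
  rintro x ⟨hx, hx'⟩ y ⟨hy, hy'⟩ a b ha hb hab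
  have key (I : Finset (Fin m)) :
      ∑ i ∈ I, (a • x + b • y) i = a * ∑ i ∈ I, x i + b * ∑ i ∈ I, y i := by
    simp [Finset.sum_add_distrib, Finset.mul_sum]
  refine ⟨?_, fun I => ?_⟩
  · rw [key, hx, hy, ← add_mul, hab, one_mul]
  · rw [key]
    calc z I = a * z I + b * z I := by rw [← add_mul, hab, one_mul]
      _ ≤ _ := by gcongr <;> apply_assumption

theorem isCompact_basePolytope (z : Finset (Fin m) → ℝ) : IsCompact (basePolytope z) := by
  have hclosed : IsClosed (basePolytope z) := by
    have h : basePolytope z = {x | ∑ i, x i = z Finset.univ} ∩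
        ⋂ I : Finset (Fin m), {x | z I ≤ ∑ i ∈ I, x i} := by
      ext x; simp [basePolytope]
    rw [h]
    exact (isClosed_eq (by fun_prop) (by fun_prop)).inter
      (isClosed_iInter fun I => isClosed_le (by fun_prop) (by fun_prop))
  -- Each coordinate is bounded below by the inequality for `{i}`, and above by the one for `{i}ᶜ`.
  have hbox : IsCompact ((EuclideanSpace.equiv (Fin m) ℝ).symm ''
      Set.Icc (fun i => z {i}) (fun i => z Finset.univ - z {i}ᶜ)) :=
    isCompact_Icc.image (EuclideanSpace.equiv (Fin m) ℝ).symm.continuous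
  refine hbox.of_isClosed_subset hclosed fun x hx => ⟨fun i => x i, ⟨fun i => ?_, fun i => ?_⟩, rfl⟩
  · simpa using hx.2 {i}
  · have h1 := hx.2 {i}ᶜ
    have h2 := Finset.sum_add_sum_compl {i} (fun i => x i)
    rw [hx.1, Finset.sum_singleton] at h2
    show x i ≤ z Finset.univ - z {i}ᶜ
    linarith

/-- A direction which does not decrease any tight inequality can be followed for a short time. -/
theorem eventually_add_smul_mem (hx : x ∈ basePolytope z) {d : EuclideanSpace ℝ (Fin m)}
    (hd : ∑ i, d i = 0)
    (htight : ∀ I : Finset (Fin m), ∑ i ∈ I, x i = z I → 0 ≤ ∑ i ∈ I, d i) :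
    ∀ᶠ ε : ℝ in 𝓝[>] 0, x + ε • d ∈ basePolytope z := by
  have key (ε : ℝ) (I : Finset (Fin m)) :
      ∑ i ∈ I, (x + ε • d) i = ∑ i ∈ I, x i + ε * ∑ i ∈ I, d i := by
    simp [Finset.sum_add_distrib, Finset.mul_sum]
  have hI (I : Finset (Fin m)) : ∀ᶠ ε : ℝ in 𝓝[>] 0, z I ≤ ∑ i ∈ I, (x + ε • d) i := by
    simp only [key]
    rcases (hx.2 I).eq_or_lt with h | h
    · filter_upwards [self_mem_nhdsWithin] with ε hε
      rw [← h]
      exact le_add_of_nonneg_right (mul_nonneg (le_of_lt hε) (htight I h.symm))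
    · have hc : Tendsto (fun ε : ℝ => ∑ i ∈ I, x i + ε * ∑ i ∈ I, d i) (𝓝[>] 0)
          (𝓝 (∑ i ∈ I, x i)) := by
        have : Continuous fun ε : ℝ => ∑ i ∈ I, x i + ε * ∑ i ∈ I, d i := by fun_prop
        simpa using (this.tendsto 0).mono_left nhdsWithin_le_nhds
      filter_upwards [hc.eventually (lt_mem_nhds h)] with ε hε using hε.le
  filter_upwards [eventually_all.2 hI] with ε hε
  exact ⟨by rw [key, hd, mul_zero, add_zero, hx.1], hε⟩

/-- An extreme point is determined by the family of its tight sets, so there are finitely many. -/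
theorem finite_extremePoints_basePolytope (z : Finset (Fin m) → ℝ) :
    ((basePolytope z).extremePoints ℝ).Finite := by
  refine Set.Finite.of_finite_image
    (f := fun x => {I : Finset (Fin m) | ∑ i ∈ I, x i = z I}) (Set.toFinite _) ?_
  intro x hx y hy hxy
  have hz : ∀ I : Finset (Fin m), ∑ i ∈ I, x i = z I → ∑ i ∈ I, (y - x) i = 0 := by
    intro I hI
    have hI' : ∑ i ∈ I, y i = z I := (Set.ext_iff.1 hxy I).1 hI
    simp [hI, hI']
  have h1 := eventually_add_smul_mem hx.1 (hz _ hx.1.1) fun I hI => (hz I hI).ge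
  have hn : ∀ I : Finset (Fin m), ∑ i ∈ I, x i = z I → ∑ i ∈ I, (-(y - x)) i = 0 := by
    intro I hI
    have := hz I hI
    simp only [PiLp.neg_apply, Finset.sum_neg_distrib, this, neg_zero]
  have h2 := eventually_add_smul_mem hx.1 (hn _ hx.1.1) fun I hI => (hn I hI).ge
  obtain ⟨ε, ⟨h1, h2⟩, hε⟩ := ((h1.and h2).and self_mem_nhdsWithin).exists
  have hε : (0 : ℝ) < ε := hε
  have h := (mem_extremePoints.1 hx).2 _ h1 _ h2
    ⟨1 / 2, 1 / 2, by norm_num, by norm_num, by norm_num, by module⟩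
  have h3 : ε • (y - x) = 0 := by simpa using h.1
  exact (sub_eq_zero.1 ((smul_eq_zero.1 h3).resolve_left hε.ne')).symm

theorem isPolytope_basePolytope (z : Finset (Fin m) → ℝ) : IsPolytope (basePolytope z) := by
  refine ⟨(finite_extremePoints_basePolytope z).toFinset, ?_⟩
  rw [Set.Finite.coe_toFinset,
    ← ((finite_extremePoints_basePolytope z).isCompact_convexHull (𝕜 := ℝ)).isClosed.closure_eq,
    closure_convexHull_extremePoints (isCompact_basePolytope z) (convex_basePolytope z)]

/-! ### Exchange properties -/

theorem sum_single_sub_single (I : Finset (Fin m)) (i j : Fin m) :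
    ∑ k ∈ I, (EuclideanSpace.single i (1 : ℝ) - EuclideanSpace.single j (1 : ℝ) :
      EuclideanSpace ℝ (Fin m)) k =
      (if i ∈ I then 1 else 0) - (if j ∈ I then 1 else 0) := by
  simp [PiLp.single_apply]

theorem eventually_add_exchange_mem (hx : x ∈ basePolytope z) {i j : Fin m}
    (h : ∀ I : Finset (Fin m), ∑ k ∈ I, x k = z I → j ∈ I → i ∈ I) :
    ∀ᶠ ε : ℝ in 𝓝[>] 0,
      x + ε • (EuclideanSpace.single i (1 : ℝ) - EuclideanSpace.single j 1) ∈ basePolytope z := by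
  refine eventually_add_smul_mem hx (by rw [sum_single_sub_single]; simp) fun I hI => ?_
  rw [sum_single_sub_single]
  have := h I hI
  split_ifs <;> simp_all

/-- Tight sets are closed under union and intersection, by supermodularity. -/
theorem tight_union_inter (hz : ∀ I J : Finset (Fin m), z I + z J ≤ z (I ∪ J) + z (I ∩ J))
    (hx : x ∈ basePolytope z) {I J : Finset (Fin m)} (hI : ∑ k ∈ I, x k = z I)
    (hJ : ∑ k ∈ J, x k = z J) :
    ∑ k ∈ I ∪ J, x k = z (I ∪ J) ∧ ∑ k ∈ I ∩ J, x k = z (I ∩ J) := by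
  have h := Finset.sum_union_inter (s₁ := I) (s₂ := J) (f := fun k => x k)
  have h1 := hx.2 (I ∪ J)
  have h2 := hx.2 (I ∩ J)
  have h3 := hz I J
  constructor <;> linarith

/-- The symmetric exchange property of base polytopes: if `x i < y i`, a small amount can be moved
from some coordinate `j` with `y j < x j` to the coordinate `i` in `x`, and back in `y`. -/
theorem exists_exchange (h0 : z ∅ = 0)
    (hz : ∀ I J : Finset (Fin m), z I + z J ≤ z (I ∪ J) + z (I ∩ J))
    (hx : x ∈ basePolytope z) (hy : y ∈ basePolytope z) {i : Fin m} (hi : x i < y i) :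
    ∃ j, y j < x j ∧ ∀ᶠ ε : ℝ in 𝓝[>] 0,
      x + ε • (EuclideanSpace.single i (1 : ℝ) - EuclideanSpace.single j 1) ∈ basePolytope z ∧
      y - ε • (EuclideanSpace.single i (1 : ℝ) - EuclideanSpace.single j 1) ∈ basePolytope z := by
  classical
  -- `A` is the least `y`-tight set containing `i`.
  obtain ⟨A, ⟨hiA, hA⟩, hAmin⟩ : ∃ A : Finset (Fin m), (i ∈ A ∧ ∑ k ∈ A, y k = z A) ∧
      ∀ I : Finset (Fin m), i ∈ I → ∑ k ∈ I, y k = z I → A ⊆ I := by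
    refine ⟨(Finset.univ.filter fun I : Finset (Fin m) =>
      i ∈ I ∧ ∑ k ∈ I, y k = z I).inf id, ?_, fun I hiI hI => ?_⟩
    · refine Finset.inf_induction (p := fun I : Finset (Fin m) => i ∈ I ∧ ∑ k ∈ I, y k = z I)
        ⟨Finset.mem_univ i, hy.1⟩ ?_ ?_
      · rintro I ⟨hiI, hI⟩ J ⟨hiJ, hJ⟩
        exact ⟨Finset.mem_inter.2 ⟨hiI, hiJ⟩, (tight_union_inter hz hy hI hJ).2⟩
      · intro I hI
        exact (Finset.mem_filter.1 hI).2
    · exact Finset.inf_le (f := id) (Finset.mem_filter.2 ⟨Finset.mem_univ I, hiI, hI⟩)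
  -- `B` is the largest `x`-tight set not containing `i`.
  obtain ⟨B, ⟨hiB, hB⟩, hBmax⟩ : ∃ B : Finset (Fin m), (i ∉ B ∧ ∑ k ∈ B, x k = z B) ∧
      ∀ I : Finset (Fin m), i ∉ I → ∑ k ∈ I, x k = z I → I ⊆ B := by
    refine ⟨(Finset.univ.filter fun I : Finset (Fin m) =>
      i ∉ I ∧ ∑ k ∈ I, x k = z I).sup id, ?_, fun I hiI hI => ?_⟩
    · refine Finset.sup_induction (p := fun I : Finset (Fin m) => i ∉ I ∧ ∑ k ∈ I, x k = z I)
        ⟨Finset.notMem_empty i, by simpa using h0.symm⟩ ?_ ?_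
      · rintro I ⟨hiI, hI⟩ J ⟨hiJ, hJ⟩
        exact ⟨fun h => (Finset.mem_union.1 h).elim hiI hiJ, (tight_union_inter hz hx hI hJ).1⟩
      · intro I hI
        exact (Finset.mem_filter.1 hI).2
    · exact Finset.le_sup (f := id) (Finset.mem_filter.2 ⟨Finset.mem_univ I, hiI, hI⟩)
  -- Supermodularity for `A` and `B` bounds the mass of `y` on `A \ B` by that of `x`.
  obtain ⟨j, hj, hji⟩ : ∃ j ∈ A \ B, y j < x j := by
    by_contra! hcon
    have hlt : ∑ k ∈ A \ B, x k < ∑ k ∈ A \ B, y k :=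
      Finset.sum_lt_sum hcon ⟨i, Finset.mem_sdiff.2 ⟨hiA, hiB⟩, hi⟩
    have e1 := Finset.sum_union (f := fun k => x k) (Finset.sdiff_disjoint (s := B) (t := A))
    rw [Finset.sdiff_union_self_eq_union] at e1
    have e2 := Finset.sum_inter_add_sum_sdiff A B (fun k => y k)
    have h1 := hx.2 (A ∪ B)
    have h2 := hy.2 (A ∩ B)
    have h3 := hz A B
    linarith
  rw [Finset.mem_sdiff] at hj
  refine ⟨j, hji, (eventually_add_exchange_mem hx fun I hI hjI => ?_).and
    ((eventually_add_exchange_mem (i := j) (j := i) hy fun I hI hiI => hAmin I hiI hI hj.1).mono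
      fun ε h => ?_)⟩
  · by_contra hiI
    exact hj.2 (hBmax I hiI hI hjI)
  · rwa [sub_eq_add_neg, ← smul_neg, neg_sub]

theorem exists_lt_of_mem_basePolytope (hx : x ∈ basePolytope z) (hy : y ∈ basePolytope z)
    (hxy : x ≠ y) : ∃ i, x i < y i := by
  by_contra! h
  refine hxy ?_
  have := (Finset.sum_eq_sum_iff_of_le (s := Finset.univ) (fun i _ => h i)).1 (hy.1.trans hx.1.symm)
  ext i
  exact (this i (Finset.mem_univ i)).symm

end Base

/-- A self-map of a nonempty finite set permutes some nonempty subset. -/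
theorem exists_nonempty_image_eq {α : Type*} [DecidableEq α] (h : α → α) (s : Finset α)
    (hs : s.Nonempty) (hmaps : s.image h ⊆ s) : ∃ I ⊆ s, I.Nonempty ∧ I.image h = I := by
  induction s using Finset.strongInduction with
  | H s ih =>
    by_cases heq : s.image h = s
    · exact ⟨s, subset_rfl, hs, heq⟩
    · obtain ⟨I, hI, h1, h2⟩ := ih _ (Finset.ssubset_iff_subset_ne.2 ⟨hmaps, heq⟩) (hs.image h)
        (Finset.image_subset_image hmaps)
      exact ⟨I, hI.trans hmaps, h1, h2⟩

theorem mem_reflection_iff {m : ℕ} {w x : EuclideanSpace ℝ (Fin m)}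
    {P : Set (EuclideanSpace ℝ (Fin m))} : x ∈ reflection w P ↔ (2 : ℝ) • w - x ∈ P := by
  constructor
  · rintro ⟨y, hy, rfl⟩
    simpa using hy
  · exact fun h => ⟨_, h, by simp⟩

/-- The point in the conclusion is the average of the points `x + ε • d i`, for `i ∈ I`. -/
theorem _root_.Convex.add_smul_sum_mem {E ι : Type*} [AddCommGroup E] [Module ℝ E] {P : Set E}
    (hP : Convex ℝ P) {x : E} {ε : ℝ} {I : Finset ι} (hI : I.Nonempty) {d : ι → E}
    (h : ∀ i ∈ I, x + ε • d i ∈ P) : x + (ε / I.card) • ∑ i ∈ I, d i ∈ P := by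
  have hc : (I.card : ℝ) ≠ 0 := by exact_mod_cast hI.card_pos.ne'
  have := hP.sum_mem (t := I) (w := fun _ => (I.card : ℝ)⁻¹) (fun _ _ => by positivity)
    (by simp [hc]) h
  convert this using 1
  rw [← Finset.smul_sum, Finset.sum_add_distrib, Finset.sum_const, smul_add, ← Finset.smul_sum,
    ← Nat.cast_smul_eq_nsmul ℝ, smul_smul, smul_smul, inv_mul_cancel₀ hc, one_smul, div_eq_inv_mul]

/-- The symmetric exchange property of `P ∩ ρ_w P`, for a base polytope `P`. Exchanges in `P` send
each coordinate `i` with `x i < y i` to some `f i` with `y (f i) < x (f i)`, and exchanges in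
`ρ_w P` send each coordinate of the second kind back to one of the first kind by a map `g`. On a
set `I` permuted by `g ∘ f`, the exchanges `i ↔ f i` in `P` and `g (f i) ↔ f i` in `ρ_w P` add up
to the same direction, the difference of the indicator vectors of `I` and `f I`. -/
theorem exists_exchange_inter_reflection {m : ℕ} {z : Finset (Fin m) → ℝ} (h0 : z ∅ = 0)
    (hz : ∀ I J : Finset (Fin m), z I + z J ≤ z (I ∪ J) + z (I ∩ J))
    {w x y : EuclideanSpace ℝ (Fin m)} (hx : x ∈ basePolytope z ∩ reflection w (basePolytope z))
    (hy : y ∈ basePolytope z ∩ reflection w (basePolytope z)) (hxy : x ≠ y) :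
    ∃ ε : ℝ, 0 < ε ∧ ∃ c : EuclideanSpace ℝ (Fin m),
      c ≠ 0 ∧ ∑ i, c i = 0 ∧ (∀ i, c i = 0 ∨ c i = 1 ∨ c i = -1) ∧
      x + ε • c ∈ basePolytope z ∩ reflection w (basePolytope z) ∧
      y - ε • c ∈ basePolytope z ∩ reflection w (basePolytope z) := by
  classical
  obtain ⟨hx, hx'⟩ := hx
  obtain ⟨hy, hy'⟩ := hy
  rw [mem_reflection_iff] at hx' hy'
  obtain ⟨i₀, hi₀⟩ := exists_lt_of_mem_basePolytope hx hy hxy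
  have : Nonempty (Fin m) := ⟨i₀⟩
  choose! f hf hfε using fun i (hi : x i < y i) => exists_exchange h0 hz hx hy hi
  have hrefl (j : Fin m) (hj : y j < x j) : ((2 : ℝ) • w - x) j < ((2 : ℝ) • w - y) j := by
    simpa using hj
  choose! g hg hgε using fun j (hj : y j < x j) => exists_exchange h0 hz hx' hy' (hrefl j hj)
  replace hg (j : Fin m) (hj : y j < x j) : x (g j) < y (g j) := by simpa using hg j hj
  obtain ⟨I, hIs, hIne, hI⟩ := exists_nonempty_image_eq (fun i => g (f i))
    (Finset.univ.filter fun i => x i < y i) ⟨i₀, by simpa using hi₀⟩ (by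
      intro k hk
      obtain ⟨i, hi, rfl⟩ := Finset.mem_image.1 hk
      simp only [Finset.mem_filter, Finset.mem_univ, true_and] at hi ⊢
      exact hg _ (hf _ hi))
  have hIlt (i : Fin m) (hi : i ∈ I) : x i < y i := by simpa using hIs hi
  have hinj : Set.InjOn (fun i => g (f i)) I := Finset.card_image_iff.1 (by rw [hI])
  have hfinj : Set.InjOn f I := fun a ha b hb hab => hinj ha hb (congrArg g hab)
  obtain ⟨ε, hε, hεpos⟩ := (((I.eventually_all (l := 𝓝[>] (0 : ℝ))).2 fun i hi =>
    (hfε i (hIlt i hi)).and (hgε (f i) (hf i (hIlt i hi)))).and self_mem_nhdsWithin).exists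
  have hεpos : 0 < ε := hεpos
  set e : Fin m → EuclideanSpace ℝ (Fin m) := fun i => EuclideanSpace.single i 1 with he
  set c : EuclideanSpace ℝ (Fin m) := ∑ i ∈ I, (e i - e (f i)) with hc
  have hc' : c = -∑ i ∈ I, (e (f i) - e (g (f i))) := by
    have : ∑ i ∈ I, e (g (f i)) = ∑ i ∈ I, e i := by
      conv_rhs => rw [← hI, Finset.sum_image hinj]
    rw [hc, Finset.sum_sub_distrib, Finset.sum_sub_distrib, this, neg_sub]
  have hcapp (k : Fin m) : c k = (if k ∈ I then 1 else 0) - (if k ∈ I.image f then 1 else 0) := by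
    rw [hc, Finset.sum_sub_distrib, ← Finset.sum_image (f := e) hfinj]
    simp [he]
  have hdisj (k : Fin m) (hk : k ∈ I) : k ∉ I.image f := by
    rw [Finset.mem_image]
    rintro ⟨i, hi, rfl⟩
    exact lt_asymm (hf i (hIlt i hi)) (hIlt _ hk)
  have hpos : 0 < ε / I.card := div_pos hεpos (by exact_mod_cast hIne.card_pos)
  refine ⟨ε / I.card, hpos, c, ?_, ?_, ?_, ⟨?_, ?_⟩, ⟨?_, ?_⟩⟩
  · intro h
    obtain ⟨k, hk⟩ := hIne
    have := hcapp k
    rw [h] at this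
    simp [hk, hdisj k hk] at this
  · simp only [hcapp, Finset.sum_sub_distrib, Finset.sum_ite_mem, Finset.univ_inter,
      Finset.sum_const, Finset.card_image_of_injOn hfinj, sub_self]
  · intro k
    rw [hcapp]
    split_ifs <;> simp
  · exact (convex_basePolytope z).add_smul_sum_mem hIne fun i hi => (hε i hi).1.1
  · rw [mem_reflection_iff]
    have := (convex_basePolytope z).add_smul_sum_mem hIne fun i hi => (hε i hi).2.1
    convert this using 1
    rw [hc']; module
  · have := (convex_basePolytope z).add_smul_sum_mem (x := y) (ε := ε)
      (d := fun i => -(e i - e (f i))) hIne fun i hi => by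
        have := (hε i hi).1.2
        rwa [sub_eq_add_neg, ← smul_neg] at this
    convert this using 1
    rw [hc, Finset.sum_neg_distrib]; module
  · rw [mem_reflection_iff]
    have := (convex_basePolytope z).add_smul_sum_mem (x := (2 : ℝ) • w - y) (ε := ε)
      (d := fun i => -(e (f i) - e (g (f i)))) hIne fun i hi => by
        have := (hε i hi).2.2
        rwa [sub_eq_add_neg, ← smul_neg] at this
    convert this using 1
    rw [hc', Finset.sum_neg_distrib]; module

/-! ### Good orientation vectors -/

section Orientation

variable {n : ℕ} {v : EuclideanSpace ℝ (Fin (n + 1))}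

theorem IsGoodOrientation.pos (hv : IsGoodOrientation v) (k : Fin (n + 1)) : 0 < v k := by
  induction k using Fin.reverseInduction with
  | last => exact hv.2
  | cast i ih => linarith [hv.1 i]

/-- The entries of a good orientation vector are superdecreasing. -/
theorem IsGoodOrientation.sum_Ioi_lt (hv : IsGoodOrientation v) (k : Fin (n + 1)) :
    ∑ i ∈ Finset.Ioi k, v i < v k := by
  induction k using Fin.reverseInduction with
  | last =>
    rw [Finset.sum_eq_zero fun i hi => absurd (Finset.mem_Ioi.1 hi) (Fin.le_last i).not_gt]
    exact hv.2
  | cast i ih =>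
    have h : Finset.Ioi i.castSucc = insert i.succ (Finset.Ioi i.succ) := by
      ext j
      rw [Finset.mem_insert, Finset.mem_Ioi, Finset.mem_Ioi, Fin.lt_def, Fin.lt_def, Fin.ext_iff]
      simp only [Fin.val_castSucc, Fin.val_succ]
      omega
    rw [h, Finset.sum_insert (by simp)]
    linarith [hv.1 i]

/-- The sign of `∑ i, c i * v i`, with coefficients in `{-1, 0, 1}`, is that of the first nonzero
coefficient. -/
theorem IsGoodOrientation.mul_sum_pos (hv : IsGoodOrientation v) {c : Fin (n + 1) → ℝ}
    (hc : ∀ i, c i = 0 ∨ c i = 1 ∨ c i = -1) {k : Fin (n + 1)} (hk : c k ≠ 0)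
    (hlt : ∀ i < k, c i = 0) : 0 < c k * ∑ i, c i * v i := by
  have hterm (i : Fin (n + 1)) :
      (if i = k then v i else 0) - (if i ∈ Finset.Ioi k then v i else 0) ≤ c k * (c i * v i) := by
    have hvi := hv.pos i
    rcases lt_trichotomy i k with h | rfl | h
    · simp [h.ne, h.not_gt, hlt i h]
    · rcases hc i with h | h | h <;> simp_all
    · rcases hc k with h1 | h1 | h1 <;> rcases hc i with h2 | h2 | h2 <;>
        simp [h, h.ne', h1, h2] <;> linarith
  calc 0 < v k - ∑ i ∈ Finset.Ioi k, v i := sub_pos.2 (hv.sum_Ioi_lt k)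
    _ = ∑ i, ((if i = k then v i else 0) - (if i ∈ Finset.Ioi k then v i else 0)) := by
      rw [Finset.sum_sub_distrib, Finset.sum_ite_eq' Finset.univ k, Finset.sum_ite_mem,
        Finset.univ_inter, if_pos (Finset.mem_univ k)]
    _ ≤ ∑ i, c k * (c i * v i) := Finset.sum_le_sum fun i _ => hterm i
    _ = c k * ∑ i, c i * v i := (Finset.mul_sum _ _ _).symm

/-- The vectors `v` and `proj v` agree on the sign of an exchange direction: its entries sum to
zero, so its first nonzero entry is not the last entry and survives the projection. -/
theorem IsGoodOrientation.inner_mul_inner_proj_pos (hv : IsGoodOrientation v)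
    {c : EuclideanSpace ℝ (Fin (n + 1))} (hc0 : c ≠ 0) (hsum : ∑ i, c i = 0)
    (hc : ∀ i, c i = 0 ∨ c i = 1 ∨ c i = -1) :
    0 < inner ℝ c v * inner ℝ (proj c) (proj v) := by
  obtain ⟨k, hk, hmin⟩ := wellFounded_lt.has_min {i | c i ≠ 0} (by
    by_contra! h
    refine hc0 ?_
    ext i
    by_contra hi
    exact Set.eq_empty_iff_forall_notMem.1 h i hi)
  have hlt (i : Fin (n + 1)) (hi : i < k) : c i = 0 := by
    by_contra h
    exact hmin i h hi
  have hlast : k ≠ Fin.last n := by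
    rintro rfl
    rw [Finset.sum_eq_single (Fin.last n) (fun i _ hi => hlt i (Fin.lt_last_iff_ne_last.2 hi))
      (by simp)] at hsum
    exact hk hsum
  have h1 := hv.mul_sum_pos hc hk hlt
  -- The projection amounts to replacing the last coefficient by zero.
  have h2 := hv.mul_sum_pos (c := fun i => if i = Fin.last n then 0 else c i) (k := k)
    (fun i => by dsimp only; split_ifs; exacts [Or.inl rfl, hc i]) (by simpa [hlast] using hk)
    (fun i hi => by simp [hlt i hi])
  have e1 : inner ℝ c v = ∑ i, c i * v i := by
    simp [PiLp.inner_apply, mul_comm]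
  have e2 : inner ℝ (proj c) (proj v) =
      ∑ i, (if i = Fin.last n then 0 else c i) * v i := by
    rw [Fin.sum_univ_castSucc]
    simp [PiLp.inner_apply, proj, mul_comm, (Fin.castSucc_lt_last _).ne]
  simp only [if_neg hlast] at h2
  rw [e1, e2]
  have h3 := mul_pos h1 h2
  rw [mul_mul_mul_comm] at h3
  exact pos_of_mul_pos_right h3 (mul_self_nonneg _)

end Orientation

/-! ### Consequences of exchange -/

/-- Any two distinct points of `S` can be moved, inside `S`, by opposite displacements which are not
perpendicular to `v`. -/
def HasExchange {m : ℕ} (S : Set (EuclideanSpace ℝ (Fin m))) (v : EuclideanSpace ℝ (Fin m)) :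
    Prop :=
  ∀ x ∈ S, ∀ y ∈ S, x ≠ y → ∃ d, inner ℝ d v ≠ 0 ∧ x + d ∈ S ∧ y - d ∈ S

section Exchange

variable {m : ℕ} {S : Set (EuclideanSpace ℝ (Fin m))} {v : EuclideanSpace ℝ (Fin m)}

/-- A functional exposing the edge `[a, b]` vanishes on an exchange displacement `d` from `a`
towards `b`, so that `d` is parallel to the edge. -/
theorem HasExchange.inner_ne_zero_of_isEdge (h : HasExchange S v) {a b : EuclideanSpace ℝ (Fin m)}
    (hab : IsEdge S a b) : inner ℝ (b - a) v ≠ 0 := by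
  obtain ⟨l, hl⟩ := hab.2 ⟨a, left_mem_segment ℝ a b⟩
  have ha := hl.subset (left_mem_segment ℝ a b)
  have hb := hl.subset (right_mem_segment ℝ a b)
  obtain ⟨d, hd, had, hbd⟩ := h a ha.1 b hb.1 hab.1
  have h1 := ha.2 _ had
  have h2 := hb.2 _ hbd
  rw [map_add] at h1
  rw [map_sub] at h2
  have hmem : a + d ∈ segment ℝ a b := by
    rw [hl]
    refine ⟨had, fun y hy => (ha.2 y hy).trans ?_⟩
    rw [map_add]
    linarith
  rw [segment_eq_image'] at hmem
  obtain ⟨t, -, ht⟩ := hmem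
  rw [← add_left_cancel ht, inner_smul_left] at hd
  exact right_ne_zero_of_mul hd

theorem HasExchange.eq_of_isTopVertex (h : HasExchange S v) {x y : EuclideanSpace ℝ (Fin m)}
    (hx : IsTopVertex v S x) (hy : IsTopVertex v S y) : x = y := by
  by_contra hxy
  obtain ⟨d, hd, hxd, hyd⟩ := h x hx.1.1 y hy.1.1 hxy
  have h1 := hx.2 _ hxd
  have h2 := hy.2 _ hyd
  rw [inner_add_left] at h1
  rw [inner_sub_left] at h2
  exact hd (by linarith)

theorem isBottomVertex_iff_isTopVertex_neg {x : EuclideanSpace ℝ (Fin m)} :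
    IsBottomVertex v S x ↔ IsTopVertex (-v) S x := by
  simp [IsBottomVertex, IsTopVertex, inner_neg_right]

theorem HasExchange.eq_of_isBottomVertex (h : HasExchange S v) {x y : EuclideanSpace ℝ (Fin m)}
    (hx : IsBottomVertex v S x) (hy : IsBottomVertex v S y) : x = y := by
  rw [isBottomVertex_iff_isTopVertex_neg] at hx hy
  refine HasExchange.eq_of_isTopVertex (fun x hx y hy hxy => ?_) hx hy
  obtain ⟨d, hd, h'⟩ := h x hx y hy hxy
  exact ⟨d, by simpa [inner_neg_right] using hd, h'⟩

theorem isPositivelyOriented_of_hasExchange {P : Set (EuclideanSpace ℝ (Fin m))}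
    (hP : IsPolytope P) (h : ∀ w ∈ P, HasExchange (P ∩ reflection w P) v) :
    IsPositivelyOriented P v :=
  ⟨hP, fun w hw _ _ hab => (h w hw).inner_ne_zero_of_isEdge hab⟩

theorem hasUniqueBottomTop_of_hasExchange {P : Set (EuclideanSpace ℝ (Fin m))}
    (hP : IsPolytope P) (h : ∀ w ∈ P, HasExchange (P ∩ reflection w P) v) :
    HasUniqueBottomTop P v := by
  intro w hw
  obtain ⟨b, hb⟩ := exists_isBottomVertex hP v hw
  obtain ⟨t, ht⟩ := exists_isTopVertex hP v hw
  exact ⟨⟨b, hb, fun _ h' => (h w hw).eq_of_isBottomVertex h' hb⟩,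
    ⟨t, ht, fun _ h' => (h w hw).eq_of_isTopVertex h' ht⟩⟩

end Exchange

/-! ### The projection -/

section Projection

variable {n : ℕ}

/-- The projection `proj` as a linear map. -/
def projLinear (n : ℕ) : EuclideanSpace ℝ (Fin (n + 1)) →ₗ[ℝ] EuclideanSpace ℝ (Fin n) where
  toFun := proj
  map_add' _ _ := rfl
  map_smul' _ _ := rfl

theorem IsPolytope.proj_image {P : Set (EuclideanSpace ℝ (Fin (n + 1)))} (hP : IsPolytope P) :
    IsPolytope (proj '' P) := by
  classical
  obtain ⟨T, rfl⟩ := hP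
  refine ⟨T.image proj, ?_⟩
  rw [Finset.coe_image]
  exact (projLinear n).image_convexHull _

theorem eq_of_proj_eq {x y : EuclideanSpace ℝ (Fin (n + 1))} (h : proj x = proj y)
    (hsum : ∑ i, x i = ∑ i, y i) : x = y := by
  have hcast (i : Fin n) : x i.castSucc = y i.castSucc := congrArg (fun u => u i) h
  rw [Fin.sum_univ_castSucc, Fin.sum_univ_castSucc, Finset.sum_congr rfl fun i _ => hcast i,
    add_right_inj] at hsum
  ext i
  exact Fin.lastCases hsum hcast i

/-- The projection is injective on the hyperplane containing `P` and `ρ_w P`, hence commutes with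
their intersection. -/
theorem proj_image_inter_reflection {P : Set (EuclideanSpace ℝ (Fin (n + 1)))} {s : ℝ}
    (hs : ∀ x ∈ P, ∑ i, x i = s) {w : EuclideanSpace ℝ (Fin (n + 1))} (hw : w ∈ P) :
    proj '' P ∩ reflection (proj w) (proj '' P) = proj '' (P ∩ reflection w P) := by
  ext q
  constructor
  · rintro ⟨⟨x, hx, rfl⟩, hq⟩
    obtain ⟨y, hy, hxy⟩ := mem_reflection_iff.1 hq
    have hy' : y = (2 : ℝ) • w - x := by
      refine eq_of_proj_eq hxy ?_
      simp only [PiLp.sub_apply, PiLp.smul_apply, smul_eq_mul, Finset.sum_sub_distrib,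
        ← Finset.mul_sum, hs x hx, hs y hy, hs w hw]
      ring
    exact ⟨x, ⟨hx, mem_reflection_iff.2 (hy' ▸ hy)⟩, rfl⟩
  · rintro ⟨x, ⟨hx, hx'⟩, rfl⟩
    exact ⟨⟨x, hx, rfl⟩, mem_reflection_iff.2 ⟨_, mem_reflection_iff.1 hx', rfl⟩⟩

variable {S : Set (EuclideanSpace ℝ (Fin (n + 1)))} {v : EuclideanSpace ℝ (Fin (n + 1))}

/-- Any two distinct points of `S` can be moved, inside `S`, by opposite displacements on which the
functionals `⟨-, v⟩` and `⟨proj -, proj v⟩` are nonzero of the same sign. -/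
def HasProjExchange (S : Set (EuclideanSpace ℝ (Fin (n + 1))))
    (v : EuclideanSpace ℝ (Fin (n + 1))) : Prop :=
  ∀ x ∈ S, ∀ y ∈ S, x ≠ y →
    ∃ d, 0 < inner ℝ d v * inner ℝ (proj d) (proj v) ∧ x + d ∈ S ∧ y - d ∈ S

theorem HasProjExchange.hasExchange (h : HasProjExchange S v) : HasExchange S v := by
  intro x hx y hy hxy
  obtain ⟨d, hd, h'⟩ := h x hx y hy hxy
  exact ⟨d, left_ne_zero_of_mul hd.ne', h'⟩

theorem HasProjExchange.hasExchange_proj (h : HasProjExchange S v) :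
    HasExchange (proj '' S) (proj v) := by
  rintro _ ⟨x, hx, rfl⟩ _ ⟨y, hy, rfl⟩ hxy
  obtain ⟨d, hd, hxd, hyd⟩ := h x hx y hy fun h => hxy (h ▸ rfl)
  exact ⟨proj d, right_ne_zero_of_mul hd.ne', ⟨_, hxd, rfl⟩, ⟨_, hyd, rfl⟩⟩

/-- If the top vertices of `S` and of its projection did not correspond, an exchange between them
would increase `⟨-, v⟩` at the former or `⟨-, proj v⟩` at the latter. -/
theorem HasProjExchange.eq_proj_of_isTopVertex (h : HasProjExchange S v)
    {x : EuclideanSpace ℝ (Fin (n + 1))} {q : EuclideanSpace ℝ (Fin n)} (hx : IsTopVertex v S x)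
    (hq : IsTopVertex (proj v) (proj '' S) q) : q = proj x := by
  obtain ⟨y, hy, rfl⟩ := hq.1.1
  by_contra hxy
  obtain ⟨d, hd, hxd, hyd⟩ := h x hx.1.1 y hy fun h => hxy (h ▸ rfl)
  have h1 := hx.2 _ hxd
  have h2 := hq.2 _ ⟨_, hyd, rfl⟩
  rw [inner_add_left] at h1
  rw [show proj (y - d) = proj y - proj d from rfl, inner_sub_left] at h2
  exact hd.not_ge (mul_nonpos_of_nonpos_of_nonneg (by linarith) (by linarith))

theorem HasProjExchange.eq_proj_of_isBottomVertex (h : HasProjExchange S v)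
    {x : EuclideanSpace ℝ (Fin (n + 1))} {q : EuclideanSpace ℝ (Fin n)} (hx : IsBottomVertex v S x)
    (hq : IsBottomVertex (proj v) (proj '' S) q) : q = proj x := by
  rw [isBottomVertex_iff_isTopVertex_neg] at hx hq
  refine HasProjExchange.eq_proj_of_isTopVertex (v := -v) (fun x hx y hy hxy => ?_) hx hq
  obtain ⟨d, hd, h'⟩ := h x hx y hy hxy
  refine ⟨d, ?_, h'⟩
  rwa [show proj (-v) = -proj v from rfl, inner_neg_right, inner_neg_right, neg_mul_neg]

theorem hasProjExchange_basePolytope {z : Finset (Fin (n + 1)) → ℝ} (h0 : z ∅ = 0)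
    (hz : ∀ I J : Finset (Fin (n + 1)), z I + z J ≤ z (I ∪ J) + z (I ∩ J))
    (hv : IsGoodOrientation v) (w : EuclideanSpace ℝ (Fin (n + 1))) :
    HasProjExchange (basePolytope z ∩ reflection w (basePolytope z)) v := by
  intro x hx y hy hxy
  obtain ⟨ε, hε, c, hc0, hsum, hc, hxc, hyc⟩ := exists_exchange_inter_reflection h0 hz hx hy hxy
  refine ⟨ε • c, ?_, hxc, hyc⟩
  rw [show proj (ε • c) = ε • proj c from rfl, real_inner_smul_left, real_inner_smul_left,
    mul_mul_mul_comm]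
  exact mul_pos (mul_pos hε hε) (hv.inner_mul_inner_proj_pos hc0 hsum hc)

end Projection

end OrientedPolytope

theorem mainTheorem11 (n : ℕ) (P : Set (EuclideanSpace ℝ (Fin (n + 1))))
    (v : EuclideanSpace ℝ (Fin (n + 1)))
    (hP : IsGeneralizedPermutahedron P) (hv : IsGoodOrientation v) :
    ∃ (hPv : IsPositivelyOriented P v) (hQv : IsPositivelyOriented (proj '' P) (proj v)),
      HasUniqueBottomTop P v ∧ HasUniqueBottomTop (proj '' P) (proj v) ∧
      diagonalMap hQv ∘ projOn P = Prod.map (projOn P) (projOn P) ∘ diagonalMap hPv := by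
  obtain ⟨z, h0, hz, hPz⟩ := hP
  obtain rfl : P = basePolytope z := hPz
  have hpoly := isPolytope_basePolytope z
  have hex := hasProjExchange_basePolytope h0 hz hv
  have himage {w : EuclideanSpace ℝ (Fin (n + 1))} (hw : w ∈ basePolytope z) :=
    proj_image_inter_reflection (fun x (hx : x ∈ basePolytope z) => hx.1) hw
  have hexP : ∀ w ∈ basePolytope z,
      HasExchange (basePolytope z ∩ reflection w (basePolytope z)) v :=
    fun w _ => (hex w).hasExchange
  have hexQ : ∀ q ∈ proj '' basePolytope z,
      HasExchange (proj '' basePolytope z ∩ reflection q (proj '' basePolytope z)) (proj v) := by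
    rintro _ ⟨w, hw, rfl⟩
    rw [himage hw]
    exact (hex w).hasExchange_proj
  refine ⟨isPositivelyOriented_of_hasExchange hpoly hexP,
    isPositivelyOriented_of_hasExchange hpoly.proj_image hexQ,
    hasUniqueBottomTop_of_hasExchange hpoly hexP,
    hasUniqueBottomTop_of_hasExchange hpoly.proj_image hexQ, ?_⟩
  funext w
  have hwQ : proj w.1 ∈ proj '' basePolytope z := ⟨w.1, w.2, rfl⟩
  have hb := (exists_isBottomVertex hpoly.proj_image (proj v) hwQ).choose_spec
  have ht := (exists_isTopVertex hpoly.proj_image (proj v) hwQ).choose_spec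
  -- The set is rewritten through `congrArg`: the chosen vertices themselves mention it, and have to
  -- stay as they are in `diagonalMap`.
  refine Prod.ext (Subtype.ext ?_) (Subtype.ext ?_)
  · exact (hex w.1).eq_proj_of_isBottomVertex
      (exists_isBottomVertex hpoly v w.2).choose_spec
      ((congrArg (IsBottomVertex (proj v) · _) (himage w.2)).mp hb)
  · exact (hex w.1).eq_proj_of_isTopVertex
      (exists_isTopVertex hpoly v w.2).choose_spec
      ((congrArg (IsTopVertex (proj v) · _) (himage w.2)).mp ht)
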